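/- Let $w>1$. For an integer $n\ge 2$ let $A(w)$ be the adjacency matrix of the graph obtained from the unweighted path with vertices $1,\dots,n$ and edges $\{j,j+1\}$, $1\le j\le n-1$, by adding a loop of weight $w$ at each of the end vertices $1$ and $n$. Let $U(t)=\exp(itA(w))$ and let $p(t)=|U(t)_{1,n}|^2$ be the fidelity of state transfer between the end vertices at readout time $t\in\mathbb R$. Let $\lambda_1\ge\lambda_2\ge\dots\ge\lambda_n$ be the eigenvalues of $A(w)$, let $V=[v_{ij}]$ be any real orthogonal matrix with $V^{T}A(w)V=\operatorname{diag}(\lambda_1,\dots,\lambda_n)$, and put $S=\sum_{\ell=3}^{n}v_{1\ell}^2$ and $$B_n=2v_{11}^2v_{12}^2(\lambda_1-\lambda_2)+2v_{11}^2(\lambda_1+2)S+2v_{12}^2(\lambda_2+2)S+4S^2 .$$ Then $p$ is differentiable, and for every $n\ge 2$ and every $t\in\mathbb R$, $$\left|\frac{dp}{dt}(t)\right|\le B_n .$$ Moreover, for fixed $w>1$, $$B_n=\frac{2w^4+4w^3-2}{w^5}+O\!\left(\frac1n\right)\qquad (n\to\infty);$$ that is, there is a constant $C$ depending only on $w$ such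 that $\left|B_n-\frac{2w^4+4w^3-2}{w^5}\right|\le \frac{C}{n}$ for all $n\ge 2$ and every such $V$. -/

import Mathlib

noncomputable section

namespace LoopedPath

open Classical in
/-- The adjacency matrix of the path on `n` vertices, with vertices `0, …, n - 1`, unit weights on
the edges `{i, i + 1}`, and a loop of weight `w` at each of the end vertices `0` and `n - 1`. -/
def adj (n : ℕ) (w : ℝ) : Matrix (Fin n) (Fin n) ℝ :=
  (SimpleGraph.pathGraph n).adjMatrix ℝ +
    Matrix.diagonal (fun i : Fin n => if i.val = 0 ∨ i.val + 1 = n then w else 0)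

/-- The transition matrix `U(t) = exp(i t A)` of the Hamiltonian `A`. -/
def transition {n : ℕ} (A : Matrix (Fin n) (Fin n) ℝ) (t : ℝ) : Matrix (Fin n) (Fin n) ℂ :=
  NormedSpace.exp ((Complex.I * (t : ℂ)) • A.map (fun x : ℝ => (x : ℂ)))

/-- The fidelity `|U(t)_{a,b}|²` of state transfer from `a` to `b` at the readout time `t`. -/
def fidelity {n : ℕ} (A : Matrix (Fin n) (Fin n) ℝ) (a b : Fin n) (t : ℝ) : ℝ :=
  ‖transition A t a b‖ ^ 2

/-- The fidelity of state transfer between the two end vertices of the looped path. -/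
def endFidelity {n : ℕ} (hn : 2 ≤ n) (w : ℝ) (t : ℝ) : ℝ :=
  fidelity (adj n w) ⟨0, by omega⟩ ⟨n - 1, by omega⟩ t

/-- `V` is an orthogonal matrix with `Vᵀ A V = diag(lam)`, where the eigenvalues are listed in
nonincreasing order. -/
structure IsOrderedDiagonalization {n : ℕ} (A V : Matrix (Fin n) (Fin n) ℝ)
    (lam : Fin n → ℝ) : Prop where
  orthogonal : V ∈ Matrix.orthogonalGroup (Fin n) ℝ
  diagonal : V.transpose * A * V = Matrix.diagonal lam
  antitone : Antitone lam

/-- The sum `S = ∑_{ℓ ≥ 3} v_{1ℓ}²` (with indices counted from one). -/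
def tailSum {n : ℕ} (hn : 2 ≤ n) (V : Matrix (Fin n) (Fin n) ℝ) : ℝ :=
  ∑ l : Fin n with 2 ≤ l.val, V ⟨0, by omega⟩ l ^ 2

/-- The expression
`2 v₁₁² v₁₂² (λ₁ - λ₂) + 2 v₁₁² (λ₁ + 2) S + 2 v₁₂² (λ₂ + 2) S + 4 S²`
(with indices counted from one). -/
def timeBound {n : ℕ} (hn : 2 ≤ n) (V : Matrix (Fin n) (Fin n) ℝ) (lam : Fin n → ℝ) : ℝ :=
  let i₁ : Fin n := ⟨0, by omega⟩
  let i₂ : Fin n := ⟨1, by omega⟩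
  2 * V i₁ i₁ ^ 2 * V i₁ i₂ ^ 2 * (lam i₁ - lam i₂)
    + 2 * V i₁ i₁ ^ 2 * (lam i₁ + 2) * tailSum hn V
    + 2 * V i₁ i₂ ^ 2 * (lam i₂ + 2) * tailSum hn V
    + 4 * tailSum hn V ^ 2

end LoopedPath

end

namespace LoopedPath

open Matrix

/-! ### The looped path matrix -/

/-! The derivative bound rests on the spectral form of the fidelity, a double sum of `cos ((lam j -
lam k) * t)` weighted by entries of `V` at the two ends. Differentiating and using `|sin| ≤ 1`
removes `t`. The reflection of the path commutes with the matrix, and no eigenvector vanishes at the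
first vertex, so each eigenvector is even or odd (`exists_parity`) and all weights become squares of
first-row entries. From the third eigenvalue on, the spectrum lies in `[-2, 2]`
(`eigenvalue_le_two`): among three eigenvectors two share a parity, and a combination of these
vanishes at both ends, where the loops are not felt. Splitting off the first two indices then gives
the bound.

For the limit, the vector `w⁻¹ ^ i` satisfies the eigenvalue equation for `w + w⁻¹ > 2` except for
an exponentially small defect at the last vertex. Since the other eigenvalues are at most `2`, this
vector lies almost entirely in the span of the first two eigenvectors. Its two end values, its norm
and its overlap with its reflection force opposite parities, `v₁₁² ≈ v₁₂² ≈ (1 - w⁻²) / 2` and `λ₁ ≈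
λ₂ ≈ w + w⁻¹` (`timeBound_sub_le_of_small`). The error is of order `n * w⁻¹ ^ (n - 1)`, far below `1
/ n`. -/

theorem adj_mulVec_apply {n : ℕ} (hn : 2 ≤ n) (w : ℝ) (x : Fin n → ℝ) (i : Fin n) :
    (adj n w *ᵥ x) i =
      (if h : 0 < i.val then x ⟨i.val - 1, by omega⟩ else w * x i) +
        (if h : i.val + 1 < n then x ⟨i.val + 1, h⟩ else w * x i) := by
  classical
  have key : ∀ k : Fin n, (if (SimpleGraph.pathGraph n).Adj i k then (1 : ℝ) else 0) * x k =
      (if i.val + 1 = k.val then x k else 0) + (if k.val + 1 = i.val then x k else 0) := by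
    intro k
    rw [SimpleGraph.pathGraph_adj]
    by_cases h1 : i.val + 1 = k.val <;> by_cases h2 : k.val + 1 = i.val <;> simp [h1, h2]
    omega
  have hsum : ∑ k, (if (SimpleGraph.pathGraph n).Adj i k then (1 : ℝ) else 0) * x k =
      (if h : i.val + 1 < n then x ⟨i.val + 1, h⟩ else 0) +
        (if h : 0 < i.val then x ⟨i.val - 1, by omega⟩ else 0) := by
    rw [Finset.sum_congr rfl fun k _ => key k, Finset.sum_add_distrib]
    congr 1
    · split_ifs with h
      · rw [Finset.sum_eq_single ⟨i.val + 1, h⟩]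
        · simp
        · intro b _ hb
          rw [if_neg]
          intro hc
          exact hb (Fin.ext hc.symm)
        · simp
      · exact Finset.sum_eq_zero fun k _ => if_neg (by omega)
    · split_ifs with h
      · rw [Finset.sum_eq_single ⟨i.val - 1, by omega⟩]
        · rw [if_pos]
          simp only
          omega
        · intro b _ hb
          rw [if_neg]
          intro hc
          exact hb (Fin.ext (by simp only; omega))
        · simp
      · exact Finset.sum_eq_zero fun k _ => if_neg (by omega)
  have hexp : (adj n w *ᵥ x) i =
      ∑ k, (if (SimpleGraph.pathGraph n).Adj i k then (1 : ℝ) else 0) * x k +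
        (if i.val = 0 ∨ i.val + 1 = n then w else 0) * x i := by
    rw [adj, add_mulVec, Pi.add_apply, mulVec_diagonal]
    congr 1
  rw [hexp, hsum]
  have hi := i.isLt
  by_cases h0 : 0 < i.val <;> by_cases h1 : i.val + 1 < n
  · have : ¬ (i.val = 0 ∨ i.val + 1 = n) := by omega
    simp only [h0, h1, this, dite_true, if_false]
    ring
  · have : i.val = 0 ∨ i.val + 1 = n := by omega
    simp only [h0, h1, this, dite_true, dite_false, if_true]
    ring
  · have : i.val = 0 ∨ i.val + 1 = n := by omega
    simp only [h0, h1, this, dite_true, dite_false, if_true]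
    ring
  -- A vertex without either neighbour would force `n = 1`.
  · omega

theorem adj_transpose (n : ℕ) (w : ℝ) : (adj n w)ᵀ = adj n w := by
  rw [adj, transpose_add, SimpleGraph.transpose_adjMatrix, diagonal_transpose]

theorem adj_mulVec_rev {n : ℕ} (hn : 2 ≤ n) (w : ℝ) (x : Fin n → ℝ) (i : Fin n) :
    (adj n w *ᵥ fun k => x k.rev) i = (adj n w *ᵥ x) i.rev := by
  rw [adj_mulVec_apply hn, adj_mulVec_apply hn, add_comm]
  have hi := i.isLt
  congr 1
  · by_cases h : i.val + 1 < n
    · rw [dif_pos h, dif_pos (by rw [Fin.val_rev]; omega)]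
      congr 1
    · rw [dif_neg h, dif_neg (by rw [Fin.val_rev]; omega)]
  · by_cases h : 0 < i.val
    · rw [dif_pos h, dif_pos (by rw [Fin.val_rev]; omega)]
      congr 1
      ext
      simp only [Fin.val_rev]
      omega
    · rw [dif_neg h, dif_neg (by rw [Fin.val_rev]; omega)]

/-- An eigenvector of the looped path does not vanish at the first vertex. -/
theorem eq_zero_of_eigenvector {n : ℕ} (hn : 2 ≤ n) (w μ : ℝ) (x : Fin n → ℝ)
    (hx : ∀ i, (adj n w *ᵥ x) i = μ * x i) (h0 : x ⟨0, by omega⟩ = 0) : x = 0 := by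
  have key : ∀ m : ℕ, ∀ h : m < n, x ⟨m, h⟩ = 0 := by
    intro m
    induction m using Nat.strong_induction_on with
    | _ m ih =>
      intro h
      rcases m with _ | m
      · exact h0
      -- Row `m` is a three-term recurrence expressing entry `m + 1` through entries `m` and `m -
      -- 1`.
      · have h1 := hx ⟨m, by omega⟩
        rw [adj_mulVec_apply hn, ih m (by omega) (by omega)] at h1
        simp only [h, dite_true, mul_zero] at h1
        by_cases hm : 0 < m
        · rw [dif_pos hm, ih (m - 1) (by omega) (by omega), zero_add] at h1
          exact h1
        · rw [dif_neg hm, zero_add] at h1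
          exact h1
  funext i
  exact key i.val i.isLt

/-! ### The quadratic form -/

/-- On each edge `|x i * x k| ≤ (x i ^ 2 + x k ^ 2) / 2`; summing over ordered adjacent pairs counts
each square once per neighbour. -/
theorem abs_dotProduct_adjMatrix_le {ι : Type*} [Fintype ι] (G : SimpleGraph ι)
    [DecidableRel G.Adj] (x : ι → ℝ) :
    |x ⬝ᵥ (G.adjMatrix ℝ *ᵥ x)| ≤ ∑ i, (G.degree i : ℝ) * x i ^ 2 := by
  have hdeg : ∀ i, (G.degree i : ℝ) = ∑ k, if G.Adj i k then (1 : ℝ) else 0 := by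
    intro i
    rw [← SimpleGraph.card_neighborFinset_eq_degree, SimpleGraph.neighborFinset_eq_filter,
      Finset.card_filter]
    push_cast
    rfl
  have h1 : x ⬝ᵥ (G.adjMatrix ℝ *ᵥ x) = ∑ i, ∑ k, if G.Adj i k then x i * x k else 0 := by
    simp only [dotProduct, mulVec, SimpleGraph.adjMatrix_apply, Finset.mul_sum]
    refine Finset.sum_congr rfl fun i _ => Finset.sum_congr rfl fun k _ => ?_
    split_ifs <;> ring
  have h2 : ∑ i, (G.degree i : ℝ) * x i ^ 2 = ∑ i, ∑ k, if G.Adj i k then x i ^ 2 else 0 := by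
    refine Finset.sum_congr rfl fun i _ => ?_
    rw [hdeg, Finset.sum_mul]
    refine Finset.sum_congr rfl fun k _ => ?_
    split_ifs <;> ring
  have h3 : ∑ i, ∑ k, (if G.Adj i k then x i ^ 2 else 0) =
      ∑ i, ∑ k, (if G.Adj i k then x k ^ 2 else 0) := by
    rw [Finset.sum_comm]
    refine Finset.sum_congr rfl fun i _ => Finset.sum_congr rfl fun k _ => ?_
    simp only [G.adj_comm]
  have h4 : ∑ i, (G.degree i : ℝ) * x i ^ 2 =
      ∑ i, ∑ k, if G.Adj i k then (x i ^ 2 + x k ^ 2) / 2 else 0 := by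
    have : ∑ i, (G.degree i : ℝ) * x i ^ 2 =
        (∑ i, ∑ k, (if G.Adj i k then x i ^ 2 else 0) +
          ∑ i, ∑ k, (if G.Adj i k then x k ^ 2 else 0)) / 2 := by
      rw [← h3, h2]; ring
    rw [this, ← Finset.sum_add_distrib, Finset.sum_div]
    refine Finset.sum_congr rfl fun i _ => ?_
    rw [← Finset.sum_add_distrib, Finset.sum_div]
    refine Finset.sum_congr rfl fun k _ => ?_
    split_ifs <;> ring
  rw [h1, h4]
  refine (Finset.abs_sum_le_sum_abs _ _).trans (Finset.sum_le_sum fun i _ => ?_)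
  refine (Finset.abs_sum_le_sum_abs _ _).trans (Finset.sum_le_sum fun k _ => ?_)
  split_ifs
  · rw [abs_le]
    constructor <;> nlinarith [sq_nonneg (x i + x k), sq_nonneg (x i - x k)]
  · simp

open Classical in
theorem pathGraph_degree_le_two (n : ℕ) (i : Fin n) :
    (SimpleGraph.pathGraph n).degree i ≤ 2 := by
  rw [← SimpleGraph.card_neighborFinset_eq_degree]
  have : ((SimpleGraph.pathGraph n).neighborFinset i).image Fin.val ⊆
      {i.val + 1, i.val - 1} := by
    intro k hk
    simp only [Finset.mem_image, SimpleGraph.mem_neighborFinset, SimpleGraph.pathGraph_adj] at hk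
    obtain ⟨k, hk, rfl⟩ := hk
    simp only [Finset.mem_insert, Finset.mem_singleton]
    omega
  calc _ = (((SimpleGraph.pathGraph n).neighborFinset i).image Fin.val).card :=
        (Finset.card_image_of_injective _ Fin.val_injective).symm
    _ ≤ _ := Finset.card_le_card this
    _ ≤ 2 := Finset.card_le_two

theorem abs_dotProduct_adj_sub_le {n : ℕ} (w : ℝ) (x : Fin n → ℝ) :
    |x ⬝ᵥ (adj n w *ᵥ x) - ∑ i : Fin n, (if i.val = 0 ∨ i.val + 1 = n then w else 0) * x i ^ 2| ≤
      2 * ∑ i, x i ^ 2 := by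
  classical
  have h : x ⬝ᵥ (adj n w *ᵥ x) -
      ∑ i : Fin n, (if i.val = 0 ∨ i.val + 1 = n then w else 0) * x i ^ 2 =
      x ⬝ᵥ ((SimpleGraph.pathGraph n).adjMatrix ℝ *ᵥ x) := by
    rw [adj, add_mulVec, dotProduct_add, add_sub_assoc]
    have : x ⬝ᵥ (diagonal (fun i : Fin n => if i.val = 0 ∨ i.val + 1 = n then w else 0) *ᵥ x) =
        ∑ i : Fin n, (if i.val = 0 ∨ i.val + 1 = n then w else 0) * x i ^ 2 := by
      rw [dotProduct]
      refine Finset.sum_congr rfl fun i _ => ?_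
      rw [mulVec_diagonal]
      ring
    convert add_zero _
    rw [sub_eq_zero]
    convert this
  rw [h, Finset.mul_sum]
  refine (abs_dotProduct_adjMatrix_le _ x).trans (Finset.sum_le_sum fun i _ => ?_)
  exact mul_le_mul_of_nonneg_right (by exact_mod_cast pathGraph_degree_le_two n i) (sq_nonneg _)

theorem neg_two_mul_le_dotProduct_adj {n : ℕ} {w : ℝ} (hw : 0 ≤ w) (x : Fin n → ℝ) :
    -(2 * ∑ i, x i ^ 2) ≤ x ⬝ᵥ (adj n w *ᵥ x) := by
  have h := (abs_le.1 (abs_dotProduct_adj_sub_le w x)).1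
  have h2 : 0 ≤ ∑ i : Fin n, (if i.val = 0 ∨ i.val + 1 = n then w else 0) * x i ^ 2 :=
    Finset.sum_nonneg fun i _ => mul_nonneg (by split_ifs <;> simp [hw]) (sq_nonneg _)
  linarith

theorem dotProduct_adj_le {n : ℕ} {w : ℝ} (hw : 0 ≤ w) (x : Fin n → ℝ) :
    x ⬝ᵥ (adj n w *ᵥ x) ≤ (w + 2) * ∑ i, x i ^ 2 := by
  have h := (abs_le.1 (abs_dotProduct_adj_sub_le w x)).2
  have h2 : ∑ i : Fin n, (if i.val = 0 ∨ i.val + 1 = n then w else 0) * x i ^ 2 ≤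
      w * ∑ i, x i ^ 2 := by
    rw [Finset.mul_sum]
    exact Finset.sum_le_sum fun i _ =>
      mul_le_mul_of_nonneg_right (by split_ifs <;> simp [hw]) (sq_nonneg _)
  linarith

/-- Such vectors do not feel the loops, so only the path, of degree at most `2`, contributes. -/
theorem dotProduct_adj_le_of_ends_eq_zero {n : ℕ} (w : ℝ) (x : Fin n → ℝ)
    (hx : ∀ i : Fin n, i.val = 0 ∨ i.val + 1 = n → x i = 0) :
    x ⬝ᵥ (adj n w *ᵥ x) ≤ 2 * ∑ i, x i ^ 2 := by
  have h := (abs_le.1 (abs_dotProduct_adj_sub_le w x)).2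
  have h2 : ∑ i : Fin n, (if i.val = 0 ∨ i.val + 1 = n then w else 0) * x i ^ 2 = 0 := by
    refine Finset.sum_eq_zero fun i _ => ?_
    split_ifs with hi
    · simp [hx i hi]
    · simp
  linarith

/-! ### Orthogonal diagonalizations -/

namespace IsOrderedDiagonalization

variable {n : ℕ} {A V : Matrix (Fin n) (Fin n) ℝ} {lam : Fin n → ℝ}

theorem mul_transpose (h : IsOrderedDiagonalization A V lam) : V * Vᵀ = 1 :=
  (mem_orthogonalGroup_iff (Fin n) ℝ).1 h.orthogonal

theorem transpose_mul (h : IsOrderedDiagonalization A V lam) : Vᵀ * V = 1 :=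
  (mem_orthogonalGroup_iff' (Fin n) ℝ).1 h.orthogonal

theorem eq_mul_diagonal_mul (h : IsOrderedDiagonalization A V lam) :
    A = V * Matrix.diagonal lam * Vᵀ := by
  rw [← h.diagonal, Matrix.mul_assoc, Matrix.mul_assoc, h.mul_transpose, Matrix.mul_one,
    ← Matrix.mul_assoc, h.mul_transpose, Matrix.one_mul]

theorem mulVec_col (h : IsOrderedDiagonalization A V lam) (j i : Fin n) :
    (A *ᵥ fun k => V k j) i = lam j * V i j := by
  have h1 : A * V = V * Matrix.diagonal lam := by
    rw [← h.diagonal, Matrix.mul_assoc, ← Matrix.mul_assoc V, h.mul_transpose, Matrix.one_mul]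
  have h2 := congrFun (congrFun h1 i) j
  rw [mul_diagonal, mul_comm] at h2
  exact h2

theorem sum_col_mul_col (h : IsOrderedDiagonalization A V lam) (j k : Fin n) :
    ∑ i, V i j * V i k = if j = k then 1 else 0 := by
  have h2 := congrFun (congrFun h.transpose_mul j) k
  rw [one_apply] at h2
  exact h2

theorem sum_row_mul_row (h : IsOrderedDiagonalization A V lam) (j k : Fin n) :
    ∑ i, V j i * V k i = if j = k then 1 else 0 := by
  have h2 := congrFun (congrFun h.mul_transpose j) k
  rw [one_apply] at h2
  exact h2

theorem sum_col_sq (h : IsOrderedDiagonalization A V lam) (j : Fin n) :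
    ∑ i, V i j ^ 2 = 1 := by
  simpa [sq] using h.sum_col_mul_col j j

theorem sum_row_sq (h : IsOrderedDiagonalization A V lam) (i : Fin n) :
    ∑ j, V i j ^ 2 = 1 := by
  simpa [sq] using h.sum_row_mul_row i i

theorem dotProduct_mulVec_col (h : IsOrderedDiagonalization A V lam) (j : Fin n) :
    (fun i => V i j) ⬝ᵥ (A *ᵥ fun i => V i j) = lam j := by
  have : A *ᵥ (fun i => V i j) = fun i => lam j * V i j := funext (h.mulVec_col j)
  rw [this, dotProduct]
  calc ∑ i, V i j * (lam j * V i j) = lam j * ∑ i, V i j ^ 2 := by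
        rw [Finset.mul_sum]
        exact Finset.sum_congr rfl fun i _ => by ring
    _ = lam j := by rw [h.sum_col_sq, mul_one]

theorem sum_coeff_mul_row (h : IsOrderedDiagonalization A V lam) (x : Fin n → ℝ) (i : Fin n) :
    ∑ j, (∑ k, x k * V k j) * V i j = x i := by
  have h1 : V *ᵥ (Vᵀ *ᵥ x) = x := by rw [mulVec_mulVec, h.mul_transpose, one_mulVec]
  conv_rhs => rw [← h1]
  simp only [mulVec, dotProduct, transpose_apply]
  refine Finset.sum_congr rfl fun j _ => ?_
  rw [mul_comm]
  congr 1
  exact Finset.sum_congr rfl fun k _ => mul_comm _ _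

theorem sum_coeff_mul_coeff (h : IsOrderedDiagonalization A V lam) (x y : Fin n → ℝ) :
    ∑ j, (∑ k, x k * V k j) * (∑ k, y k * V k j) = ∑ i, x i * y i := by
  calc ∑ j, (∑ k, x k * V k j) * (∑ k, y k * V k j)
      = ∑ j, ∑ k, (∑ k, x k * V k j) * (y k * V k j) :=
        Finset.sum_congr rfl fun j _ => Finset.mul_sum _ _ _
    _ = ∑ k, ∑ j, (∑ k, x k * V k j) * (y k * V k j) := Finset.sum_comm
    _ = ∑ k, y k * ∑ j, (∑ k, x k * V k j) * V k j := by
        refine Finset.sum_congr rfl fun k _ => ?_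
        rw [Finset.mul_sum]
        exact Finset.sum_congr rfl fun j _ => by ring
    _ = ∑ i, x i * y i := by
        refine Finset.sum_congr rfl fun k _ => ?_
        rw [h.sum_coeff_mul_row, mul_comm]

theorem transition_apply (h : IsOrderedDiagonalization A V lam) (t : ℝ) (a b : Fin n) :
    transition A t a b =
      ∑ j, ((V a j * V b j : ℝ) : ℂ) * Complex.exp (((lam j * t : ℝ) : ℂ) * Complex.I) := by
  set W : Matrix (Fin n) (Fin n) ℂ := V.map Complex.ofRealHom with hW
  have hA : A.map (fun x : ℝ => (x : ℂ)) = W * Matrix.diagonal (fun j => (lam j : ℂ)) * Wᵀ := by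
    have h1 := congrArg (fun M => Matrix.map M Complex.ofRealHom) h.eq_mul_diagonal_mul
    simp only [Matrix.map_mul, diagonal_map (map_zero Complex.ofRealHom)] at h1
    exact h1
  have hWW : W * Wᵀ = 1 := by
    rw [hW, ← transpose_map, ← Matrix.map_mul, h.mul_transpose]
    exact Matrix.map_one _ (map_zero _) (map_one _)
  have hinv : W⁻¹ = Wᵀ := inv_eq_right_inv hWW
  have hU : IsUnit W := IsUnit.of_mul_eq_one _ hWW
  have hd : (Complex.I * (t : ℂ)) • Matrix.diagonal (fun j => (lam j : ℂ)) =
      Matrix.diagonal (fun j => ((lam j * t : ℝ) : ℂ) * Complex.I) := by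
    rw [← diagonal_smul]
    congr 1
    funext j
    simp only [Pi.smul_apply, smul_eq_mul, Complex.ofReal_mul]
    ring
  rw [transition, hA, ← smul_mul_assoc, ← mul_smul_comm, hd, ← hinv, exp_conj _ _ hU,
    exp_diagonal, hinv, mul_apply]
  refine Finset.sum_congr rfl fun j _ => ?_
  rw [mul_diagonal, transpose_apply, Pi.coe_exp, ← Complex.exp_eq_exp_ℂ, hW, map_apply,
    map_apply, Complex.ofRealHom_eq_coe, Complex.ofRealHom_eq_coe]
  push_cast
  ring

theorem fidelity_eq (h : IsOrderedDiagonalization A V lam) (t : ℝ) (a b : Fin n) :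
    fidelity A a b t = ∑ j, ∑ k, V a j * V b j * (V a k * V b k) *
      Real.cos ((lam j - lam k) * t) := by
  have hre : (transition A t a b).re = ∑ j, V a j * V b j * Real.cos (lam j * t) := by
    rw [h.transition_apply, Complex.re_sum]
    refine Finset.sum_congr rfl fun j _ => ?_
    rw [Complex.re_ofReal_mul, Complex.exp_ofReal_mul_I_re]
  have him : (transition A t a b).im = ∑ j, V a j * V b j * Real.sin (lam j * t) := by
    rw [h.transition_apply, Complex.im_sum]
    refine Finset.sum_congr rfl fun j _ => ?_
    rw [Complex.im_ofReal_mul, Complex.exp_ofReal_mul_I_im]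
  rw [fidelity, Complex.sq_norm, Complex.normSq_apply, hre, him, Finset.sum_mul_sum,
    Finset.sum_mul_sum, ← Finset.sum_add_distrib]
  refine Finset.sum_congr rfl fun j _ => ?_
  rw [← Finset.sum_add_distrib]
  refine Finset.sum_congr rfl fun k _ => ?_
  rw [sub_mul, Real.cos_sub]
  ring

theorem hasDerivAt_fidelity (h : IsOrderedDiagonalization A V lam) (t : ℝ) (a b : Fin n) :
    HasDerivAt (fidelity A a b) (∑ j, ∑ k, V a j * V b j * (V a k * V b k) *
      (-Real.sin ((lam j - lam k) * t) * (lam j - lam k))) t := by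
  have h1 : fidelity A a b = fun t => ∑ j, ∑ k, V a j * V b j * (V a k * V b k) *
      Real.cos ((lam j - lam k) * t) := funext fun t => h.fidelity_eq t a b
  rw [h1]
  refine HasDerivAt.fun_sum fun j _ => HasDerivAt.fun_sum fun k _ => ?_
  refine HasDerivAt.const_mul _ (HasDerivAt.cos ?_)
  simpa using (hasDerivAt_id t).const_mul (lam j - lam k)

/-- Bounding every sine by `1` makes the estimate uniform in `t`. -/
theorem abs_deriv_fidelity_le (h : IsOrderedDiagonalization A V lam) (t : ℝ) (a b : Fin n) :
    |deriv (fidelity A a b) t| ≤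
      ∑ j, ∑ k, |V a j * V b j| * |V a k * V b k| * |lam j - lam k| := by
  rw [(h.hasDerivAt_fidelity t a b).deriv]
  refine (Finset.abs_sum_le_sum_abs _ _).trans (Finset.sum_le_sum fun j _ => ?_)
  refine (Finset.abs_sum_le_sum_abs _ _).trans (Finset.sum_le_sum fun k _ => ?_)
  rw [abs_mul, abs_mul (V a j * V b j), abs_mul (-_), abs_neg]
  refine mul_le_mul_of_nonneg_left ?_ (by positivity)
  exact mul_le_of_le_one_left (abs_nonneg _) (Real.abs_sin_le_one _)

end IsOrderedDiagonalization

/-! ### Eigenvectors of the looped path -/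

section Spectrum

variable {n : ℕ} {w : ℝ} {V : Matrix (Fin n) (Fin n) ℝ} {lam : Fin n → ℝ}

theorem entry_zero_ne_zero (hn : 2 ≤ n) (h : IsOrderedDiagonalization (adj n w) V lam)
    (j : Fin n) : V ⟨0, by omega⟩ j ≠ 0 := by
  intro h0
  have h1 := eq_zero_of_eigenvector hn w (lam j) (fun i => V i j) (h.mulVec_col j) h0
  have h2 := h.sum_col_sq j
  have h3 : ∀ i, V i j = 0 := fun i => congrFun h1 i
  simp [h3] at h2

/-- Every eigenvector of the looped path is symmetric or antisymmetric. -/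
theorem exists_parity (hn : 2 ≤ n) (h : IsOrderedDiagonalization (adj n w) V lam) (j : Fin n) :
    ∃ ε : ℝ, (ε = 1 ∨ ε = -1) ∧ ∀ i, V i.rev j = ε * V i j := by
  set o : Fin n := ⟨0, by omega⟩ with ho
  have hne : V o j ≠ 0 := entry_zero_ne_zero hn h j
  -- Reflection preserves the eigenspace, and this combination of the eigenvector with its
  -- reflection vanishes at the first vertex, hence everywhere.
  have hz : (fun i => V o j * V i.rev j - V o.rev j * V i j) = 0 := by
    refine eq_zero_of_eigenvector hn w (lam j) _ (fun i => ?_) (by simp only [← ho]; ring)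
    have h1 : (fun i => V o j * V i.rev j - V o.rev j * V i j) =
        V o j • (fun i => V i.rev j) - V o.rev j • (fun i => V i j) := by
      funext i
      simp
    rw [h1, mulVec_sub, mulVec_smul, mulVec_smul]
    simp only [Pi.sub_apply, Pi.smul_apply, smul_eq_mul]
    rw [adj_mulVec_rev hn w (fun i => V i j), h.mulVec_col, h.mulVec_col]
    ring
  have hz' : ∀ i, V o j * V i.rev j = V o.rev j * V i j := fun i => sub_eq_zero.1 (congrFun hz i)
  refine ⟨V o.rev j / V o j, ?_, fun i => ?_⟩
  -- At the last vertex the proportionality says that the two end entries have equal squares, so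
  -- their ratio is a sign.
  · have h2 := hz' o.rev
    rw [Fin.rev_rev] at h2
    rw [div_eq_iff hne, div_eq_iff hne]
    rcases mul_self_eq_mul_self_iff.1 h2 with h3 | h3
    · left; linarith
    · right; linarith
  · rw [div_mul_eq_mul_div, eq_div_iff hne, ← hz' i, mul_comm]

theorem neg_two_le_eigenvalue (hw : 0 ≤ w) (h : IsOrderedDiagonalization (adj n w) V lam)
    (j : Fin n) : -2 ≤ lam j := by
  have h1 := neg_two_mul_le_dotProduct_adj hw (fun i => V i j)
  rw [h.dotProduct_mulVec_col, h.sum_col_sq] at h1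
  linarith

theorem eigenvalue_le (hw : 0 ≤ w) (h : IsOrderedDiagonalization (adj n w) V lam)
    (j : Fin n) : lam j ≤ w + 2 := by
  have h1 := dotProduct_adj_le hw (fun i => V i j)
  rw [h.dotProduct_mulVec_col, h.sum_col_sq] at h1
  linarith

/-- Two eigenvectors of the same parity cannot both have an eigenvalue above `2`. -/
theorem min_eigenvalue_le_two (hn : 2 ≤ n) (h : IsOrderedDiagonalization (adj n w) V lam)
    {j k : Fin n} (hjk : j ≠ k) {ε : ℝ} (hj : ∀ i, V i.rev j = ε * V i j)
    (hk : ∀ i, V i.rev k = ε * V i k) : min (lam j) (lam k) ≤ 2 := by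
  set o : Fin n := ⟨0, by omega⟩ with ho
  have hnej : V o j ≠ 0 := entry_zero_ne_zero hn h j
  by_contra hlt
  rw [not_le, lt_min_iff] at hlt
  -- This combination vanishes at the first vertex, and by the common parity also at the last, so
  -- its quadratic form is at most `2 * ‖z‖²`; two eigenvalues above `2` would contradict that.
  set z : Fin n → ℝ := fun i => V o j * V i k - V o k * V i j with hz
  have hAz : adj n w *ᵥ z = fun i => V o j * (lam k * V i k) - V o k * (lam j * V i j) := by
    have h1 : z = V o j • (fun i => V i k) - V o k • (fun i => V i j) := by
      funext i
      simp [hz]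
    rw [h1, mulVec_sub, mulVec_smul, mulVec_smul]
    funext i
    simp only [Pi.sub_apply, Pi.smul_apply, smul_eq_mul]
    rw [h.mulVec_col, h.mulVec_col]
  have hjk0 : ∑ i, V i j * V i k = 0 := by rw [h.sum_col_mul_col, if_neg hjk]
  have hsq : ∑ i, z i ^ 2 = V o j ^ 2 + V o k ^ 2 := by
    calc ∑ i, z i ^ 2 = V o j ^ 2 * (∑ i, V i k ^ 2) + V o k ^ 2 * (∑ i, V i j ^ 2)
          - 2 * V o j * V o k * ∑ i, V i j * V i k := by
          rw [Finset.mul_sum, Finset.mul_sum, Finset.mul_sum, ← Finset.sum_add_distrib,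
            ← Finset.sum_sub_distrib]
          exact Finset.sum_congr rfl fun i _ => by simp only [hz]; ring
      _ = _ := by rw [h.sum_col_sq, h.sum_col_sq, hjk0]; ring
  have hq : z ⬝ᵥ (adj n w *ᵥ z) = lam k * V o j ^ 2 + lam j * V o k ^ 2 := by
    rw [hAz, dotProduct]
    calc ∑ i, z i * (V o j * (lam k * V i k) - V o k * (lam j * V i j))
        = lam k * V o j ^ 2 * (∑ i, V i k ^ 2) + lam j * V o k ^ 2 * (∑ i, V i j ^ 2)
          - (lam j + lam k) * V o j * V o k * ∑ i, V i j * V i k := by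
          rw [Finset.mul_sum, Finset.mul_sum, Finset.mul_sum, ← Finset.sum_add_distrib,
            ← Finset.sum_sub_distrib]
          exact Finset.sum_congr rfl fun i _ => by simp only [hz]; ring
      _ = _ := by rw [h.sum_col_sq, h.sum_col_sq, hjk0]; ring
  have hends : ∀ i : Fin n, i.val = 0 ∨ i.val + 1 = n → z i = 0 := by
    rintro i (hi | hi)
    · have : i = o := Fin.ext hi
      simp only [hz, this]
      ring
    · have : i = o.rev := Fin.ext (by rw [Fin.val_rev]; simp only [ho]; omega)
      simp only [hz, this, hj, hk]
      ring
  have hle := dotProduct_adj_le_of_ends_eq_zero w z hends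
  rw [hq, hsq] at hle
  have h1 : 0 < V o j ^ 2 := by positivity
  nlinarith [sq_nonneg (V o k), mul_pos (sub_pos.2 hlt.2) h1,
    mul_nonneg (sub_pos.2 hlt.1).le (sq_nonneg (V o k))]

/-- Pigeonhole: three eigenvalues above `2` would carry only two possible parities. -/
theorem eigenvalue_le_two (hn : 2 ≤ n) (h : IsOrderedDiagonalization (adj n w) V lam)
    {l : Fin n} (hl : 2 ≤ l.val) : lam l ≤ 2 := by
  by_contra hlt
  rw [not_le] at hlt
  set i₁ : Fin n := ⟨0, by omega⟩ with h₁
  set i₂ : Fin n := ⟨1, by omega⟩ with h₂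
  have hn1 : i₁ ≠ i₂ := by simp [h₁, h₂]
  have hn2 : i₁ ≠ l := fun e => by have := congrArg Fin.val e; simp only [h₁] at this; omega
  have hn3 : i₂ ≠ l := fun e => by have := congrArg Fin.val e; simp only [h₂] at this; omega
  have hl1 : 2 < lam i₁ := hlt.trans_le (h.antitone (Fin.le_def.2 (by simp [h₁])))
  have hl2 : 2 < lam i₂ := hlt.trans_le (h.antitone (Fin.le_def.2 (by simp only [h₂]; omega)))
  obtain ⟨a, ha, ha'⟩ := exists_parity hn h i₁
  obtain ⟨b, hb, hb'⟩ := exists_parity hn h i₂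
  obtain ⟨c, hc, hc'⟩ := exists_parity hn h l
  have key : a = b ∨ a = c ∨ b = c := by
    rcases ha with rfl | rfl <;> rcases hb with rfl | rfl <;> rcases hc with rfl | rfl <;> simp
  rcases key with rfl | rfl | rfl
  · exact absurd (min_eigenvalue_le_two hn h hn1 ha' hb') (not_le.2 (lt_min hl1 hl2))
  · exact absurd (min_eigenvalue_le_two hn h hn2 ha' hc') (not_le.2 (lt_min hl1 hlt))
  · exact absurd (min_eigenvalue_le_two hn h hn3 hb' hc') (not_le.2 (lt_min hl2 hlt))

end Spectrum

/-! ### The bound on the derivative -/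

theorem sum_eq_add_add_sum {n : ℕ} (hn : 2 ≤ n) (f : Fin n → ℝ) :
    ∑ j, f j = f ⟨0, by omega⟩ + f ⟨1, by omega⟩ + ∑ l : Fin n with 2 ≤ l.val, f l := by
  obtain ⟨m, rfl⟩ := Nat.exists_eq_add_of_le' hn
  rw [Fin.sum_univ_succ, Fin.sum_univ_succ, Finset.sum_filter, Fin.sum_univ_succ,
    Fin.sum_univ_succ]
  have : ∀ i : Fin m, 2 ≤ i.succ.succ.val := fun i => by simp
  simp only [this, if_true]
  simp only [Fin.val_zero, Fin.val_succ, Nat.not_ofNat_le_one, nonpos_iff_eq_zero, if_false,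
    OfNat.ofNat_ne_zero, zero_add]
  rw [← add_assoc]
  rfl

/-- A head eigenvalue differs from a tail one by at most `lam i + 2`, and two tail eigenvalues
differ by at most `4`. Off-diagonal blocks occur twice, which gives the factors `2`. -/
theorem sum_sum_le_timeBound {n : ℕ} (hn : 2 ≤ n) (V : Matrix (Fin n) (Fin n) ℝ)
    {lam : Fin n → ℝ} (hanti : Antitone lam) (hlow : ∀ j, -2 ≤ lam j)
    (hup : ∀ l : Fin n, 2 ≤ l.val → lam l ≤ 2) :
    ∑ j, ∑ k, V ⟨0, by omega⟩ j ^ 2 * V ⟨0, by omega⟩ k ^ 2 * |lam j - lam k| ≤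
      timeBound hn V lam := by
  set o : Fin n := ⟨0, by omega⟩ with ho
  set i₂ : Fin n := ⟨1, by omega⟩ with h₂
  set S := tailSum hn V with hS
  have hS' : S = ∑ l : Fin n with 2 ≤ l.val, V o l ^ 2 := rfl
  have h12 : |lam o - lam i₂| = lam o - lam i₂ :=
    abs_of_nonneg (sub_nonneg.2 (hanti (Fin.le_def.2 (by simp [ho]))))
  have head : ∀ i : Fin n, i.val ≤ 2 → ∑ l : Fin n with 2 ≤ l.val,
      V o i ^ 2 * V o l ^ 2 * |lam i - lam l| ≤ V o i ^ 2 * (lam i + 2) * S := by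
    intro i hi
    rw [hS', Finset.mul_sum]
    refine Finset.sum_le_sum fun l hl => ?_
    have hl2 : 2 ≤ l.val := (Finset.mem_filter.1 hl).2
    have h1 : lam l ≤ lam i := hanti (Fin.le_def.2 (hi.trans hl2))
    rw [abs_of_nonneg (sub_nonneg.2 h1)]
    have h2 : V o i ^ 2 * V o l ^ 2 * (lam i - lam l) ≤ V o i ^ 2 * V o l ^ 2 * (lam i + 2) :=
      mul_le_mul_of_nonneg_left (by linarith [hlow l]) (by positivity)
    linarith
  have tail : ∑ j : Fin n with 2 ≤ j.val, ∑ l : Fin n with 2 ≤ l.val,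
      V o j ^ 2 * V o l ^ 2 * |lam j - lam l| ≤ 4 * S ^ 2 := by
    rw [sq, hS', Finset.sum_mul_sum, Finset.mul_sum]
    refine Finset.sum_le_sum fun j hj => ?_
    rw [Finset.mul_sum]
    refine Finset.sum_le_sum fun l hl => ?_
    have hj2 := hup j (Finset.mem_filter.1 hj).2
    have hl2 := hup l (Finset.mem_filter.1 hl).2
    have h1 : |lam j - lam l| ≤ 4 := abs_le.2 ⟨by linarith [hlow j], by linarith [hlow l]⟩
    have h2 := mul_le_mul_of_nonneg_left h1 (by positivity : 0 ≤ V o j ^ 2 * V o l ^ 2)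
    linarith
  have swap : ∀ i : Fin n, ∑ j : Fin n with 2 ≤ j.val,
      V o j ^ 2 * V o i ^ 2 * |lam j - lam i| =
      ∑ l : Fin n with 2 ≤ l.val, V o i ^ 2 * V o l ^ 2 * |lam i - lam l| := fun i =>
    Finset.sum_congr rfl fun l _ => by rw [abs_sub_comm]; ring
  have ho' := head o (by simp [ho])
  have hi' := head i₂ (by simp [h₂])
  rw [sum_eq_add_add_sum hn]
  simp only [sum_eq_add_add_sum hn, Finset.sum_add_distrib, ← ho, ← h₂, swap]
  rw [abs_sub_comm (lam i₂) (lam o), h12, sub_self, sub_self, abs_zero, timeBound]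
  simp only [← ho, ← h₂, ← hS]
  linarith

theorem abs_deriv_endFidelity_le {n : ℕ} (hn : 2 ≤ n) {w : ℝ} (hw : 0 ≤ w)
    {V : Matrix (Fin n) (Fin n) ℝ} {lam : Fin n → ℝ}
    (h : IsOrderedDiagonalization (adj n w) V lam) (t : ℝ) :
    DifferentiableAt ℝ (endFidelity hn w) t ∧
      |deriv (endFidelity hn w) t| ≤ timeBound hn V lam := by
  refine ⟨(h.hasDerivAt_fidelity t _ _).differentiableAt,
    (h.abs_deriv_fidelity_le t _ _).trans ?_⟩
  have hlast : (⟨n - 1, by omega⟩ : Fin n) = (⟨0, by omega⟩ : Fin n).rev :=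
    Fin.ext (by rw [Fin.val_rev])
  have habs : ∀ j, |V ⟨0, by omega⟩ j * V ⟨n - 1, by omega⟩ j| = V ⟨0, by omega⟩ j ^ 2 := by
    intro j
    obtain ⟨ε, hε, hrev⟩ := exists_parity hn h j
    rw [hlast, hrev, abs_mul, abs_mul, ← sq_abs (V _ j)]
    rcases hε with rfl | rfl <;> simp [sq]
  simp only [habs]
  exact sum_sum_le_timeBound hn V h.antitone (neg_two_le_eigenvalue hw h)
    fun l hl => eigenvalue_le_two hn h hl

/-! ### Perturbation estimates -/

/-- Here `b` is a quasimode coefficient and `x` the first entry of the eigenvector: `x ^ 2 = (b * x)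
^ 2 / b ^ 2 ≈ (1 / 4) / (M / 2) = τ / 2`. Division is safe because `E ≤ 1 / 8` keeps `b ^ 2 ≥ 1 /
4`. -/
theorem abs_sq_sub_le_of_approx {M τ E b x μ ν : ℝ} (hM : M * τ = 1) (hM1 : 1 ≤ M)
    (hE : E ≤ 1 / 8) (hbx : |b * x - 1 / 2| ≤ 2 * E) (hb : |b ^ 2 - M / 2| ≤ 2 * E)
    (hν : |(ν - μ) * b| ≤ E) : |x ^ 2 - τ / 2| ≤ 14 * E ∧ |ν - μ| ≤ 2 * E := by
  have hE0 : 0 ≤ E := (abs_nonneg _).trans hν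
  have hτ0 : 0 ≤ τ := by nlinarith
  have hτ1 : τ ≤ 1 := by nlinarith
  have hb4 : 1 / 4 ≤ b ^ 2 := by linarith [(abs_le.1 hb).1]
  have hb2 : 1 / 2 ≤ |b| := by
    by_contra hlt
    have : |b| ^ 2 < 1 / 4 := by nlinarith [abs_nonneg b, not_le.1 hlt]
    rw [sq_abs] at this
    linarith
  refine ⟨?_, ?_⟩
  · have h1 : b ^ 2 * (x ^ 2 - τ / 2) =
        (b * x - 1 / 2) * (b * x - 1 / 2 + 1) - (b ^ 2 - M / 2) * (τ / 2) := by
      linear_combination (-1 / 4 : ℝ) * hM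
    have h2 : |b ^ 2 * (x ^ 2 - τ / 2)| ≤ 2 * E * (5 / 4) + 2 * E * (1 / 2) := by
      rw [h1]
      refine (abs_sub _ _).trans ?_
      rw [abs_mul, abs_mul]
      refine add_le_add (mul_le_mul hbx ?_ (abs_nonneg _) (by linarith))
        (mul_le_mul hb ?_ (abs_nonneg _) (by linarith))
      · have := abs_le.1 hbx
        exact abs_le.2 ⟨by linarith, by linarith⟩
      · rw [abs_of_nonneg (by linarith)]
        linarith
    rw [abs_mul, abs_of_nonneg (sq_nonneg b)] at h2
    have h3 := mul_le_mul_of_nonneg_right hb4 (abs_nonneg (x ^ 2 - τ / 2))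
    linarith
  · rw [abs_mul] at hν
    have h3 := mul_le_mul_of_nonneg_left hb2 (abs_nonneg (ν - μ))
    linarith

/-- Equal signs would put `b * x + c * y` near both `1` and `0`. With opposite signs, sum and
difference are both known, which determines each term. -/
theorem approx_of_parity {M E b c x y ε₁ ε₂ : ℝ} (hε₁ : ε₁ = 1 ∨ ε₁ = -1)
    (hε₂ : ε₂ = 1 ∨ ε₂ = -1) (hE : E ≤ 1 / 8) (h1 : |b * x + c * y - 1| ≤ E)
    (h2 : |ε₁ * (b * x) + ε₂ * (c * y)| ≤ 2 * E) (h3 : |ε₁ * b ^ 2 + ε₂ * c ^ 2| ≤ 2 * E)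
    (h4 : |b ^ 2 + c ^ 2 - M| ≤ 2 * E) :
    (|b * x - 1 / 2| ≤ 2 * E ∧ |b ^ 2 - M / 2| ≤ 2 * E) ∧
      |c * y - 1 / 2| ≤ 2 * E ∧ |c ^ 2 - M / 2| ≤ 2 * E := by
  simp only [abs_le] at *
  obtain ⟨h1a, h1b⟩ := h1
  obtain ⟨h2a, h2b⟩ := h2
  obtain ⟨h3a, h3b⟩ := h3
  obtain ⟨h4a, h4b⟩ := h4
  rcases hε₁ with rfl | rfl <;> rcases hε₂ with rfl | rfl
  · exfalso; linarith
  · refine ⟨⟨⟨?_, ?_⟩, ?_, ?_⟩, ⟨?_, ?_⟩, ?_, ?_⟩ <;> linarith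
  · refine ⟨⟨⟨?_, ?_⟩, ?_, ?_⟩, ⟨?_, ?_⟩, ?_, ?_⟩ <;> linarith
  · exfalso; linarith

theorem abs_bound_sub_le {X Y S σ μ ν₁ ν₂ E : ℝ} (hX : 0 ≤ X) (hY : 0 ≤ Y) (hS : 0 ≤ S)
    (hsum : X + Y + S = 1) (hσ0 : 0 ≤ σ) (hσ1 : σ ≤ 1) (hμ : 0 ≤ μ)
    (hXE : |X - (1 - σ) / 2| ≤ 14 * E) (hYE : |Y - (1 - σ) / 2| ≤ 14 * E)
    (h1 : |ν₁ - μ| ≤ 2 * E) (h2 : |ν₂ - μ| ≤ 2 * E) :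
    |2 * X * Y * (ν₁ - ν₂) + 2 * X * (ν₁ + 2) * S + 2 * Y * (ν₂ + 2) * S + 4 * S ^ 2 -
      (2 * σ * (1 - σ) * (μ + 2) + 4 * σ ^ 2)| ≤ (16 + 28 * (2 * (μ + 2) + 8)) * E := by
  have hE0 : 0 ≤ E := by linarith [abs_nonneg (ν₁ - μ)]
  have hSσ : |S - σ| ≤ 28 * E := by
    have e : S - σ = -(X - (1 - σ) / 2) - (Y - (1 - σ) / 2) := by linarith
    rw [e]
    refine (abs_sub _ _).trans ?_
    rw [abs_neg]
    linarith
  have hXY : X * Y ≤ 1 := by nlinarith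
  have hXS : X * S ≤ 1 := by nlinarith
  have hYS : Y * S ≤ 1 := by nlinarith
  -- After eliminating `X` by `X + Y + S = 1`, the difference is linear in the errors `ν₁ - μ`, `ν₂
  -- - μ` and `S - σ` with bounded coefficients.
  have e : 2 * X * Y * (ν₁ - ν₂) + 2 * X * (ν₁ + 2) * S + 2 * Y * (ν₂ + 2) * S + 4 * S ^ 2 -
      (2 * σ * (1 - σ) * (μ + 2) + 4 * σ ^ 2) =
      2 * (X * Y) * ((ν₁ - μ) - (ν₂ - μ)) + 2 * (X * S) * (ν₁ - μ) + 2 * (Y * S) * (ν₂ - μ) +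
      (S - σ) * (2 * (μ + 2) * (1 - S - σ) + 4 * (S + σ)) := by
    have : X = 1 - Y - S := by linarith
    subst this
    ring
  have b1 : |2 * (X * Y) * ((ν₁ - μ) - (ν₂ - μ))| ≤ 2 * 1 * (4 * E) := by
    rw [abs_mul, abs_of_nonneg (by positivity : 0 ≤ 2 * (X * Y))]
    exact mul_le_mul (by linarith) ((abs_sub _ _).trans (by linarith)) (abs_nonneg _) (by norm_num)
  have b2 : |2 * (X * S) * (ν₁ - μ)| ≤ 2 * 1 * (2 * E) := by
    rw [abs_mul, abs_of_nonneg (by positivity : 0 ≤ 2 * (X * S))]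
    exact mul_le_mul (by linarith) h1 (abs_nonneg _) (by norm_num)
  have b3 : |2 * (Y * S) * (ν₂ - μ)| ≤ 2 * 1 * (2 * E) := by
    rw [abs_mul, abs_of_nonneg (by positivity : 0 ≤ 2 * (Y * S))]
    exact mul_le_mul (by linarith) h2 (abs_nonneg _) (by norm_num)
  have b4 : |(S - σ) * (2 * (μ + 2) * (1 - S - σ) + 4 * (S + σ))| ≤
      28 * E * (2 * (μ + 2) * 1 + 8) := by
    rw [abs_mul]
    refine mul_le_mul hSσ ((abs_add_le _ _).trans (add_le_add ?_ ?_)) (abs_nonneg _) (by positivity)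
    · rw [abs_mul, abs_of_nonneg (by positivity : 0 ≤ 2 * (μ + 2))]
      exact mul_le_mul_of_nonneg_left (abs_le.2 ⟨by linarith, by linarith⟩) (by positivity)
    · rw [abs_of_nonneg (by positivity)]
      linarith
  rw [e]
  refine (abs_add_le _ _).trans ((add_le_add ((abs_add_le _ _).trans
    (add_le_add ((abs_add_le _ _).trans (add_le_add b1 b2)) b3)) b4).trans (le_of_eq ?_))
  ring

/-- A crude bound independent of `n`, for the cases where the perturbation error is not small. -/
theorem abs_bound_le {X Y S w ν₁ ν₂ : ℝ} (hX : 0 ≤ X) (hY : 0 ≤ Y) (hS : 0 ≤ S)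
    (hsum : X + Y + S = 1) (hw : 0 ≤ w) (h1 : -2 ≤ ν₁) (h1' : ν₁ ≤ w + 2) (h2 : -2 ≤ ν₂)
    (h2' : ν₂ ≤ w + 2) :
    |2 * X * Y * (ν₁ - ν₂) + 2 * X * (ν₁ + 2) * S + 2 * Y * (ν₂ + 2) * S + 4 * S ^ 2| ≤
      6 * w + 28 := by
  have hXY : X * Y ≤ 1 := by nlinarith
  have hXS : X * S ≤ 1 := by nlinarith
  have hYS : Y * S ≤ 1 := by nlinarith
  have b1 : |2 * X * Y * (ν₁ - ν₂)| ≤ 2 * (w + 4) := by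
    rw [abs_mul, mul_assoc 2, abs_of_nonneg (by positivity : 0 ≤ 2 * (X * Y))]
    exact mul_le_mul (by linarith) (abs_le.2 ⟨by linarith, by linarith⟩) (abs_nonneg _)
      (by norm_num)
  have b2 : |2 * X * (ν₁ + 2) * S| ≤ 2 * (w + 4) := by
    rw [show 2 * X * (ν₁ + 2) * S = 2 * (X * S) * (ν₁ + 2) by ring, abs_mul,
      abs_of_nonneg (by positivity : 0 ≤ 2 * (X * S))]
    exact mul_le_mul (by linarith) (abs_le.2 ⟨by linarith, by linarith⟩) (abs_nonneg _)
      (by norm_num)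
  have b3 : |2 * Y * (ν₂ + 2) * S| ≤ 2 * (w + 4) := by
    rw [show 2 * Y * (ν₂ + 2) * S = 2 * (Y * S) * (ν₂ + 2) by ring, abs_mul,
      abs_of_nonneg (by positivity : 0 ≤ 2 * (Y * S))]
    exact mul_le_mul (by linarith) (abs_le.2 ⟨by linarith, by linarith⟩) (abs_nonneg _)
      (by norm_num)
  have b4 : |4 * S ^ 2| ≤ 4 := by
    rw [abs_of_nonneg (by positivity)]
    nlinarith
  refine (abs_add_le _ _).trans ((add_le_add ((abs_add_le _ _).trans
    (add_le_add ((abs_add_le _ _).trans (add_le_add b1 b2)) b3)) b4).trans (le_of_eq ?_))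
  ring

/-! ### The exponential quasimode -/

/-- At the first vertex the loop term `w * 1` replaces the missing neighbour value `w⁻¹ ^ (-1)`
exactly. At the last vertex it should be `w⁻¹` times the entry but is `w` times it, which is the
whole defect. -/
theorem adj_mulVec_pow {n : ℕ} (hn : 2 ≤ n) {w : ℝ} (hw : w ≠ 0) :
    adj n w *ᵥ (fun i : Fin n => w⁻¹ ^ i.val) =
      fun i => (w + w⁻¹) * w⁻¹ ^ i.val +
        if i = ⟨n - 1, by omega⟩ then (w - w⁻¹) * w⁻¹ ^ (n - 1) else 0 := by
  funext i
  obtain ⟨i, hi⟩ := i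
  rw [adj_mulVec_apply hn]
  simp only [Fin.mk.injEq]
  have hpred : ∀ m : ℕ, w⁻¹ ^ m = w * w⁻¹ ^ (m + 1) := by
    intro m
    rw [pow_succ]
    field_simp
  rcases i with _ | i
  · have h1 : 0 + 1 < n := by omega
    have h2 : ¬ 0 = n - 1 := by omega
    rw [dif_neg (lt_irrefl 0), dif_pos h1, if_neg h2]
    ring
  · by_cases h1 : i + 1 + 1 < n
    · have h2 : ¬ i + 1 = n - 1 := by omega
      rw [dif_pos (Nat.succ_pos i), dif_pos h1, if_neg h2, Nat.add_sub_cancel, hpred i]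
      ring
    · have h2 : i + 1 = n - 1 := by omega
      rw [dif_pos (Nat.succ_pos i), dif_neg h1, if_pos h2, ← h2, Nat.add_sub_cancel, hpred i]
      ring

section Quasimode

variable {n : ℕ} {w : ℝ} {V : Matrix (Fin n) (Fin n) ℝ} {lam : Fin n → ℝ}

/-- The coefficient of the exponential quasimode `i ↦ w⁻ⁱ` along the `j`-th column of `V`. -/
noncomputable def quasimodeCoeff (w : ℝ) (V : Matrix (Fin n) (Fin n) ℝ) (j : Fin n) : ℝ :=
  ∑ k, w⁻¹ ^ k.val * V k j

/-- Pair the defect equation with an eigenvector and move the symmetric matrix across. -/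
theorem eigenvalue_sub_mul_quasimodeCoeff (hn : 2 ≤ n) (hw : w ≠ 0)
    (h : IsOrderedDiagonalization (adj n w) V lam) (j : Fin n) :
    (lam j - (w + w⁻¹)) * quasimodeCoeff w V j =
      (w - w⁻¹) * w⁻¹ ^ (n - 1) * V ⟨n - 1, by omega⟩ j := by
  set ψ : Fin n → ℝ := fun i => w⁻¹ ^ i.val with hψ
  have h1 : (adj n w *ᵥ ψ) ⬝ᵥ (fun i => V i j) = lam j * quasimodeCoeff w V j := by
    rw [dotProduct_comm, dotProduct_mulVec, ← mulVec_transpose, adj_transpose, dotProduct,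
      quasimodeCoeff, Finset.mul_sum]
    refine Finset.sum_congr rfl fun i _ => ?_
    rw [h.mulVec_col]
    ring
  have h2 : (adj n w *ᵥ ψ) ⬝ᵥ (fun i => V i j) = (w + w⁻¹) * quasimodeCoeff w V j +
      (w - w⁻¹) * w⁻¹ ^ (n - 1) * V ⟨n - 1, by omega⟩ j := by
    rw [hψ, adj_mulVec_pow hn hw, dotProduct, quasimodeCoeff, Finset.mul_sum]
    simp only [add_mul, ite_mul, zero_mul, Finset.sum_add_distrib, Finset.sum_ite_eq',
      Finset.mem_univ, if_true, mul_assoc]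
  linarith

theorem sum_quasimodeCoeff_mul (h : IsOrderedDiagonalization (adj n w) V lam) (i : Fin n) :
    ∑ j, quasimodeCoeff w V j * V i j = w⁻¹ ^ i.val :=
  h.sum_coeff_mul_row (fun i : Fin n => w⁻¹ ^ i.val) i

theorem sum_quasimodeCoeff_sq (h : IsOrderedDiagonalization (adj n w) V lam) :
    (∑ j, quasimodeCoeff w V j ^ 2) * (1 - w⁻¹ ^ 2) = 1 - w⁻¹ ^ (2 * n) := by
  have h1 := h.sum_coeff_mul_coeff (fun i : Fin n => w⁻¹ ^ i.val) (fun i : Fin n => w⁻¹ ^ i.val)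
  have h2 : ∑ j, quasimodeCoeff w V j ^ 2 = ∑ i ∈ Finset.range n, (w⁻¹ ^ 2) ^ i := by
    rw [Finset.sum_range]
    simp only [sq (quasimodeCoeff w V _)]
    refine h1.trans (Finset.sum_congr rfl fun i _ => ?_)
    rw [← pow_mul, mul_comm 2, pow_mul, sq]
  rw [h2, pow_mul]
  exact geom_sum_mul_neg _ _

/-- Parseval for the quasimode and its reflection: all products `w⁻¹ ^ i * w⁻¹ ^ (n - 1 - i)` are
equal, whence the factor `n`. -/
theorem sum_parity_mul_quasimodeCoeff_sq (h : IsOrderedDiagonalization (adj n w) V lam)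
    {ε : Fin n → ℝ} (hε : ∀ j i, V i.rev j = ε j * V i j) :
    ∑ j, ε j * quasimodeCoeff w V j ^ 2 = n * w⁻¹ ^ (n - 1) := by
  have h1 := h.sum_coeff_mul_coeff (fun i : Fin n => w⁻¹ ^ i.val)
    (fun i : Fin n => w⁻¹ ^ i.rev.val)
  have h2 : ∀ j, ∑ k : Fin n, w⁻¹ ^ k.rev.val * V k j = ε j * quasimodeCoeff w V j := by
    intro j
    rw [← Equiv.sum_comp Fin.revPerm, quasimodeCoeff, Finset.mul_sum]
    refine Finset.sum_congr rfl fun k _ => ?_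
    rw [Fin.revPerm_apply, Fin.rev_rev, hε]
    ring
  simp only [h2] at h1
  calc ∑ j, ε j * quasimodeCoeff w V j ^ 2
      = ∑ j, (∑ k : Fin n, w⁻¹ ^ k.val * V k j) * (ε j * quasimodeCoeff w V j) :=
        Finset.sum_congr rfl fun j _ => by rw [quasimodeCoeff]; ring
    _ = ∑ i : Fin n, w⁻¹ ^ i.val * w⁻¹ ^ i.rev.val := h1
    _ = ∑ _i : Fin n, w⁻¹ ^ (n - 1) := by
        refine Finset.sum_congr rfl fun i _ => ?_
        rw [← pow_add, Fin.val_rev]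
        congr 1
        have := i.isLt
        omega
    _ = n * w⁻¹ ^ (n - 1) := by simp

theorem abs_tail_sum_le {ι : Type*} (s : Finset ι) {κ : ℝ} {u v ε : ι → ℝ}
    (hκ : 0 ≤ κ) (hε : ∀ l, |ε l| = 1) (hu : ∀ l ∈ s, |u l| ≤ κ * |v l|)
    (hv : ∑ l ∈ s, v l ^ 2 ≤ 1) :
    |∑ l ∈ s, ε l * (u l * v l)| ≤ κ ∧ |∑ l ∈ s, ε l * u l ^ 2| ≤ κ ^ 2 := by
  constructor
  · calc |∑ l ∈ s, ε l * (u l * v l)| ≤ ∑ l ∈ s, |ε l * (u l * v l)| :=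
          Finset.abs_sum_le_sum_abs _ _
      _ ≤ ∑ l ∈ s, κ * v l ^ 2 := by
          refine Finset.sum_le_sum fun l hl => ?_
          rw [abs_mul, hε, one_mul, abs_mul, ← sq_abs (v l), sq, ← mul_assoc]
          exact mul_le_mul_of_nonneg_right (hu l hl) (abs_nonneg _)
      _ = κ * ∑ l ∈ s, v l ^ 2 := (Finset.mul_sum _ _ _).symm
      _ ≤ κ := mul_le_of_le_one_right hκ hv
  · calc |∑ l ∈ s, ε l * u l ^ 2| ≤ ∑ l ∈ s, |ε l * u l ^ 2| := Finset.abs_sum_le_sum_abs _ _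
      _ ≤ ∑ l ∈ s, κ ^ 2 * v l ^ 2 := by
          refine Finset.sum_le_sum fun l hl => ?_
          rw [abs_mul, hε, one_mul, abs_pow, ← sq_abs (v l), ← mul_pow]
          exact pow_le_pow_left₀ (abs_nonneg _) (hu l hl) 2
      _ = κ ^ 2 * ∑ l ∈ s, v l ^ 2 := (Finset.mul_sum _ _ _).symm
      _ ≤ κ ^ 2 := mul_le_of_le_one_right (sq_nonneg _) hv

end Quasimode

/-! ### Asymptotics of the bound -/

theorem add_inv_sub_two_pos {w : ℝ} (hw : 1 < w) : 0 < w + w⁻¹ - 2 := by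
  have hw0 : 0 < w := by linarith
  have h1 : 0 < w - 1 := by linarith
  have h2 : w + w⁻¹ - 2 = (w - 1) ^ 2 * w⁻¹ := by field_simp; ring
  rw [h2]
  positivity

section Asymptotics

variable {n : ℕ} {w : ℝ} {V : Matrix (Fin n) (Fin n) ℝ} {lam : Fin n → ℝ}

theorem sq_add_sq_add_tailSum (hn : 2 ≤ n) {A : Matrix (Fin n) (Fin n) ℝ}
    (h : IsOrderedDiagonalization A V lam) :
    V ⟨0, by omega⟩ ⟨0, by omega⟩ ^ 2 + V ⟨0, by omega⟩ ⟨1, by omega⟩ ^ 2 + tailSum hn V = 1 := by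
  rw [← h.sum_row_sq ⟨0, by omega⟩, sum_eq_add_add_sum hn]
  rfl

theorem tailSum_nonneg (hn : 2 ≤ n) (V : Matrix (Fin n) (Fin n) ℝ) : 0 ≤ tailSum hn V :=
  Finset.sum_nonneg fun _ _ => sq_nonneg _

/-- The spectral gap `w + w⁻¹ - 2` between the tail and the quasimode energy divides the defect. -/
theorem abs_quasimodeCoeff_tail_le (hn : 2 ≤ n) (hw : 1 < w)
    (h : IsOrderedDiagonalization (adj n w) V lam) {l : Fin n} (hl : 2 ≤ l.val) :
    |quasimodeCoeff w V l| ≤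
      w / (w + w⁻¹ - 2) * w⁻¹ ^ (n - 1) * |V ⟨n - 1, by omega⟩ l| := by
  have hw0 : 0 < w := by linarith
  have hθ : 0 < w⁻¹ := inv_pos.2 hw0
  have hθ1 : w⁻¹ < 1 := inv_lt_one_of_one_lt₀ hw
  have hδ := add_inv_sub_two_pos hw
  have h1 := congrArg abs (eigenvalue_sub_mul_quasimodeCoeff hn hw0.ne' h l)
  rw [abs_mul, abs_mul, abs_of_nonneg (mul_nonneg (by linarith) (by positivity) :
    0 ≤ (w - w⁻¹) * w⁻¹ ^ (n - 1)), abs_of_nonpos (by linarith [eigenvalue_le_two hn h hl])] at h1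
  have h2 : (w + w⁻¹ - 2) * |quasimodeCoeff w V l| ≤ w * w⁻¹ ^ (n - 1) *
      |V ⟨n - 1, by omega⟩ l| := by
    calc (w + w⁻¹ - 2) * |quasimodeCoeff w V l|
        ≤ -(lam l - (w + w⁻¹)) * |quasimodeCoeff w V l| :=
          mul_le_mul_of_nonneg_right (by linarith [eigenvalue_le_two hn h hl]) (abs_nonneg _)
      _ = (w - w⁻¹) * w⁻¹ ^ (n - 1) * |V ⟨n - 1, by omega⟩ l| := h1
      _ ≤ _ := by gcongr; linarith
  rw [div_mul_eq_mul_div, div_mul_eq_mul_div, le_div_iff₀ hδ]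
  linarith

/-- The rate constant of the perturbation estimates. -/
noncomputable def rateConst (w : ℝ) : ℝ :=
  w / (w + w⁻¹ - 2) + (w / (w + w⁻¹ - 2)) ^ 2 + w + (1 - w⁻¹ ^ 2)⁻¹ + 1

theorem timeBound_sub_le_of_small (hn : 2 ≤ n) (hw : 1 < w)
    (h : IsOrderedDiagonalization (adj n w) V lam) {E : ℝ}
    (hE : E = rateConst w * (n * w⁻¹ ^ (n - 1))) (hE8 : E ≤ 1 / 8) :
    |timeBound hn V lam - (2 * w⁻¹ ^ 2 * (1 - w⁻¹ ^ 2) * (w + w⁻¹ + 2) + 4 * (w⁻¹ ^ 2) ^ 2)| ≤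
      (16 + 28 * (2 * (w + w⁻¹ + 2) + 8)) * E := by
  have hw0 : 0 < w := by linarith
  have hθ : 0 < w⁻¹ := inv_pos.2 hw0
  have hθ1 : w⁻¹ < 1 := inv_lt_one_of_one_lt₀ hw
  have hδ := add_inv_sub_two_pos hw
  set τ := 1 - w⁻¹ ^ 2 with hτ
  have hθsq : w⁻¹ ^ 2 < 1 := pow_lt_one₀ hθ.le hθ1 two_ne_zero
  have hτ0 : 0 < τ := by linarith
  set M := τ⁻¹ with hMdef
  have hM : M * τ = 1 := inv_mul_cancel₀ hτ0.ne'
  have hM1 : 1 ≤ M := (one_le_inv₀ hτ0).2 (by linarith [sq_nonneg w⁻¹])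
  set ρ := w / (w + w⁻¹ - 2) with hρ
  have hρ0 : 0 < ρ := by positivity
  set q := w⁻¹ ^ (n - 1) with hq
  have hq0 : 0 < q := by positivity
  have hq1 : q ≤ 1 := pow_le_one₀ hθ.le hθ1.le
  have hn1 : (1 : ℝ) ≤ n := by exact_mod_cast (by omega : 1 ≤ n)
  have hqn : q ≤ n * q := le_mul_of_one_le_left hq0.le hn1
  -- In order, the summands pay for the tail products, the tail squares, the defect, the truncated
  -- geometric series, and the reflection overlap together with the last entry.
  have hEq : E = ρ * (n * q) + ρ ^ 2 * (n * q) + w * (n * q) + M * (n * q) + n * q := by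
    rw [hE, rateConst]
    ring
  have hκ0 : 0 ≤ ρ * q := by positivity
  have e1 : ρ * q ≤ ρ * (n * q) := mul_le_mul_of_nonneg_left hqn hρ0.le
  have e2 : (ρ * q) ^ 2 ≤ ρ ^ 2 * (n * q) := by
    rw [mul_pow]
    exact mul_le_mul_of_nonneg_left (by nlinarith) (sq_nonneg _)
  have e3 : w * q ≤ w * (n * q) := mul_le_mul_of_nonneg_left hqn hw0.le
  have e4 : M * q ≤ M * (n * q) := mul_le_mul_of_nonneg_left hqn (by linarith)
  have p1 : 0 ≤ ρ * (n * q) := by positivity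
  have p2 : 0 ≤ ρ ^ 2 * (n * q) := by positivity
  have p3 : 0 ≤ w * (n * q) := by positivity
  have p4 : 0 ≤ M * (n * q) := by positivity
  have p5 : 0 ≤ n * q := by positivity
  choose ε hε hrev using exists_parity hn h
  have hεabs : ∀ j, |ε j| = 1 := fun j => by rcases hε j with e | e <;> simp [e]
  set o : Fin n := ⟨0, by omega⟩ with ho
  set i₂ : Fin n := ⟨1, by omega⟩ with h₂
  have hlast : (⟨n - 1, by omega⟩ : Fin n) = o.rev := Fin.ext (by rw [Fin.val_rev])
  have hVlast : ∀ j, V ⟨n - 1, by omega⟩ j = ε j * V o j := fun j => by rw [hlast, hrev]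
  have hVabs : ∀ j, |V ⟨n - 1, by omega⟩ j| = |V o j| := fun j => by
    rw [hVlast, abs_mul, hεabs, one_mul]
  set u := quasimodeCoeff w V with hu
  have htail : ∀ l ∈ Finset.univ.filter (fun l : Fin n => 2 ≤ l.val),
      |u l| ≤ ρ * q * |V o l| := fun l hl => by
    have h1 := abs_quasimodeCoeff_tail_le hn hw h (Finset.mem_filter.1 hl).2
    rwa [hVabs] at h1
  have hsum := sq_add_sq_add_tailSum hn h
  have hv : ∑ l : Fin n with 2 ≤ l.val, V o l ^ 2 ≤ 1 := by
    have h1 : tailSum hn V = ∑ l : Fin n with 2 ≤ l.val, V o l ^ 2 := rfl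
    rw [← h1]
    nlinarith [sq_nonneg (V o o), sq_nonneg (V o i₂)]
  obtain ⟨t1, t2⟩ := abs_tail_sum_le _ hκ0 hεabs htail hv
  obtain ⟨t3, t4⟩ := abs_tail_sum_le (ε := fun _ => 1) _ hκ0 (fun _ => abs_one) htail hv
  simp only [one_mul] at t3 t4
  -- `s1` to `s4` record the quasimode's first entry, last entry, overlap with its reflection and
  -- squared norm, each split into two head terms and a tail.
  have s1 := sum_quasimodeCoeff_mul h o
  rw [sum_eq_add_add_sum hn, ← hu, ← ho, ← h₂, ho, pow_zero, ← ho] at s1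
  have s2 := sum_quasimodeCoeff_mul h ⟨n - 1, by omega⟩
  rw [Finset.sum_congr rfl fun j _ => show quasimodeCoeff w V j * V ⟨n - 1, by omega⟩ j =
    ε j * (u j * V o j) by rw [hVlast]; ring, sum_eq_add_add_sum hn, ← ho, ← h₂, ← hq] at s2
  have s3 := sum_parity_mul_quasimodeCoeff_sq h hrev
  rw [sum_eq_add_add_sum hn, ← hu, ← ho, ← h₂, ← hq] at s3
  have s4 := sum_quasimodeCoeff_sq h
  rw [sum_eq_add_add_sum hn, ← hu, ← ho, ← h₂, ← hτ] at s4
  have s4' : u o ^ 2 + u i₂ ^ 2 + ∑ l : Fin n with 2 ≤ l.val, u l ^ 2 = M - M * w⁻¹ ^ (2 * n) := by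
    rw [← eq_div_iff hτ0.ne'] at s4
    rw [s4, div_eq_mul_inv, ← hMdef]
    ring
  have hpow : w⁻¹ ^ (2 * n) ≤ q := pow_le_pow_of_le_one hθ.le hθ1.le (by omega)
  have hMq : M * w⁻¹ ^ (2 * n) ≤ M * q := mul_le_mul_of_nonneg_left hpow (by linarith)
  have hMq0 : 0 ≤ M * w⁻¹ ^ (2 * n) := by positivity
  have hev : ∀ j, |(lam j - (w + w⁻¹)) * u j| ≤ E := by
    intro j
    rw [hu, eigenvalue_sub_mul_quasimodeCoeff hn hw0.ne' h j, abs_mul, hVabs,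
      abs_of_nonneg (mul_nonneg (by linarith) (by positivity))]
    have hVo : |V o j| ≤ 1 := by
      rw [← sq_le_one_iff_abs_le_one, ← h.sum_row_sq o]
      exact Finset.single_le_sum (f := fun j => V o j ^ 2) (fun _ _ => sq_nonneg _)
        (Finset.mem_univ j)
    calc (w - w⁻¹) * q * |V o j| ≤ w * q * 1 := by
          gcongr
          linarith
      _ ≤ E := by linarith
  rw [abs_le] at t1 t2 t3 t4
  obtain ⟨⟨a1, a2⟩, a3, a4⟩ := approx_of_parity (M := M) (E := E) (hε o) (hε i₂) hE8
    (abs_le.2 ⟨by linarith, by linarith⟩ : |u o * V o o + u i₂ * V o i₂ - 1| ≤ E)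
    (abs_le.2 ⟨by linarith, by linarith⟩)
    (abs_le.2 ⟨by linarith, by linarith⟩) (abs_le.2 ⟨by linarith, by linarith⟩)
  obtain ⟨b1, b2⟩ := abs_sq_sub_le_of_approx hM hM1 hE8 a1 a2 (hev o)
  obtain ⟨b3, b4⟩ := abs_sq_sub_le_of_approx hM hM1 hE8 a3 a4 (hev i₂)
  exact abs_bound_sub_le (sq_nonneg _) (sq_nonneg _) (tailSum_nonneg hn V) hsum (sq_nonneg w⁻¹)
    hθsq.le (by positivity) b1 b3 b2 b4

theorem abs_timeBound_le (hn : 2 ≤ n) (hw : 0 ≤ w)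
    (h : IsOrderedDiagonalization (adj n w) V lam) : |timeBound hn V lam| ≤ 6 * w + 28 :=
  abs_bound_le (sq_nonneg _) (sq_nonneg _) (tailSum_nonneg hn V) (sq_add_sq_add_tailSum hn h) hw
    (neg_two_le_eigenvalue hw h _) (eigenvalue_le hw h _) (neg_two_le_eigenvalue hw h _)
    (eigenvalue_le hw h _)

theorem exists_natCast_mul_pow_le (hw : 1 < w) :
    ∃ C : ℝ, ∀ n : ℕ, 2 ≤ n → n * w⁻¹ ^ (n - 1) ≤ C / n := by
  have hw0 : 0 < w := by linarith
  have hθ : |w⁻¹| < 1 := by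
    rw [abs_of_pos (inv_pos.2 hw0)]
    exact inv_lt_one_of_one_lt₀ hw
  obtain ⟨C, hC⟩ := (tendsto_pow_const_mul_const_pow_of_abs_lt_one 2 hθ).bddAbove_range
  refine ⟨C * w, fun n hn => ?_⟩
  have hn0 : (0 : ℝ) < n := by exact_mod_cast (by omega : 0 < n)
  -- Exponential decay beats `n ^ 2`; one factor `n` comes from the rate, the other from the target
  -- `C / n`.
  have h1 : (n : ℝ) ^ 2 * w⁻¹ ^ n ≤ C := hC ⟨n, rfl⟩
  rw [le_div_iff₀ hn0]
  have h2 : w⁻¹ ^ n * w = w⁻¹ ^ (n - 1) := by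
    obtain ⟨m, rfl⟩ := Nat.exists_eq_add_of_le' (by omega : 1 ≤ n)
    rw [Nat.add_sub_cancel, pow_succ]
    field_simp
  calc (n : ℝ) * w⁻¹ ^ (n - 1) * n = n ^ 2 * w⁻¹ ^ n * w := by rw [← h2]; ring
    _ ≤ C * w := mul_le_mul_of_nonneg_right h1 hw0.le

theorem exists_abs_timeBound_sub_le (hw : 1 < w) :
    ∃ C : ℝ, ∀ (n : ℕ) (hn : 2 ≤ n) (V : Matrix (Fin n) (Fin n) ℝ) (lam : Fin n → ℝ),
      IsOrderedDiagonalization (adj n w) V lam →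
        |timeBound hn V lam - (2 * w ^ 4 + 4 * w ^ 3 - 2) / w ^ 5| ≤ C / (n : ℝ) := by
  have hw0 : 0 < w := by linarith
  have hlim : (2 * w ^ 4 + 4 * w ^ 3 - 2) / w ^ 5 =
      2 * w⁻¹ ^ 2 * (1 - w⁻¹ ^ 2) * (w + w⁻¹ + 2) + 4 * (w⁻¹ ^ 2) ^ 2 := by
    field_simp
    ring
  rw [hlim]
  set L := 2 * w⁻¹ ^ 2 * (1 - w⁻¹ ^ 2) * (w + w⁻¹ + 2) + 4 * (w⁻¹ ^ 2) ^ 2 with hL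
  obtain ⟨C, hC⟩ := exists_natCast_mul_pow_le hw
  have hδ := add_inv_sub_two_pos hw
  have hτ : 0 < 1 - w⁻¹ ^ 2 :=
    sub_pos.2 (pow_lt_one₀ (inv_pos.2 hw0).le (inv_lt_one_of_one_lt₀ hw) two_ne_zero)
  have hR : 0 < rateConst w := by
    rw [rateConst]
    positivity
  set K₁ := 16 + 28 * (2 * (w + w⁻¹ + 2) + 8) with hK₁
  set K₂ := (6 * w + 28 + |L|) * 8 with hK₂
  have hK₁0 : 0 ≤ K₁ := by positivity
  have hK₂0 : 0 ≤ K₂ := by positivity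
  refine ⟨(K₁ + K₂) * (rateConst w * C), fun n hn V lam h => ?_⟩
  set E := rateConst w * (n * w⁻¹ ^ (n - 1)) with hE
  have hE0 : 0 ≤ E := by positivity
  have hEC : E ≤ rateConst w * C / n := by
    rw [mul_div_assoc]
    exact mul_le_mul_of_nonneg_left (hC n hn) hR.le
  have key : |timeBound hn V lam - L| ≤ (K₁ + K₂) * E := by
    rcases le_or_gt E (1 / 8) with h8 | h8
    · have h1 := timeBound_sub_le_of_small hn hw h hE h8
      nlinarith [mul_nonneg hK₂0 hE0]
    -- Here `8 * E > 1`, so the crude bound is absorbed into `K₂ * E`.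
    · have h1 := (abs_sub (timeBound hn V lam) L).trans
        (add_le_add_left (abs_timeBound_le hn hw0.le h) |L|)
      have h2 : (6 * w + 28 + |L|) * 1 ≤ (6 * w + 28 + |L|) * (8 * E) :=
        mul_le_mul_of_nonneg_left (by linarith) (by positivity)
      nlinarith [mul_nonneg hK₁0 hE0]
  calc |timeBound hn V lam - L| ≤ (K₁ + K₂) * E := key
    _ ≤ (K₁ + K₂) * (rateConst w * C / n) := mul_le_mul_of_nonneg_left hEC (by positivity)
    _ = _ := by ring

end Asymptotics

end LoopedPath

theorem mainTheorem7 (w : ℝ) (hw : 1 < w) :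
    (∀ (n : ℕ) (hn : 2 ≤ n) (V : Matrix (Fin n) (Fin n) ℝ) (lam : Fin n → ℝ),
      LoopedPath.IsOrderedDiagonalization (LoopedPath.adj n w) V lam →
        ∀ t : ℝ, DifferentiableAt ℝ (LoopedPath.endFidelity hn w) t ∧
          |deriv (LoopedPath.endFidelity hn w) t| ≤ LoopedPath.timeBound hn V lam) ∧
    (∃ C : ℝ, ∀ (n : ℕ) (hn : 2 ≤ n) (V : Matrix (Fin n) (Fin n) ℝ) (lam : Fin n → ℝ),
      LoopedPath.IsOrderedDiagonalization (LoopedPath.adj n w) V lam →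
        |LoopedPath.timeBound hn V lam - (2 * w ^ 4 + 4 * w ^ 3 - 2) / w ^ 5| ≤ C / (n : ℝ)) :=
  ⟨fun _ hn _ _ h t => LoopedPath.abs_deriv_endFidelity_le hn (by linarith) h t,
    LoopedPath.exists_abs_timeBound_sub_le hw⟩
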